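/- Let $I=[0,1]$. For a space $Y$ with basepoint $y_0$ and $k\ge 1$, let $\Pi_k(Y)$ be the set of continuous maps $a\colon I^k\to Y$ taking $\partial I^k$ to $y_0$. For an open set $E\subset I^k$, let $\Pi(E,Y)$ be the set of continuous maps $E\to Y$ taking $E\cap\partial I^k$ to $y_0$. For a finite open cover $\Gamma$ of $I^k$ and an integer $r\ge 0$, let $\Gamma(r)$ be the set of all unions of at most $r$ elements of $\Gamma$ (including the empty union). Let $L$ be an abelian group. The degree $\deg f\in\{0,1,2,\dots,\infty\}$ of a function $f\colon\Pi_k(Y)\to L$ is the infimum of the integers $r\ge 0$ such that for every finite open cover $\Gamma$ of $I^k$ there exist functions $f_E\colon\Pi(E,Y)\to L$, $E\in\Gamma(r)$, with $$f(a)=\sum_{E\in\Gamma(r)}f_E(a|_E)\qquad\text{for all }a\in\Pi_k(Y)$$ (and $\deg f=\infty$ if there is no such $r$). The function $f$ is called homotopy invariant if $f(a)=f(b)$ whenever $a$ and $b$ are homotopic relative to $\partial I^k$. **Corollary 3.2.** Let $m\ge 1$ and $n=m+1$. Let $X$ be a simply connected topological space with basepoint $x_0$, let $\Omega X$ be its space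 of loops at $x_0$ (with the compact-open topology and the constant loop as basepoint), let $L$ be an abelian group, and let $g\colon\Pi_{n-1}(\Omega X)\to L$ be a homotopy invariant function. Let $\Xi\colon\Pi_n(X)\to\Pi_{n-1}(\Omega X)$ be the bijection $$\Xi(a)(t_1,\dots,t_{n-1})(t)=a(t_1,\dots,t_{n-1},t).$$ Then $$\deg(g\circ\Xi)\le(n-1)\deg g,$$ where $(n-1)\cdot\infty=\infty$. -/

import Mathlib

open TopologicalSpace
open scoped unitInterval

noncomputable section

namespace SpheroidFunctional

universe u v

/-- The set `Π_n(X)` of `n`-spheroids in the space `X` with basepoint `x`: continuous maps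
from the cube `I^n` to `X` that take `∂I^n` to `x`. -/
abbrev Spheroid (n : ℕ) (X : Type u) [TopologicalSpace X] (x : X) : Type u :=
  GenLoop (Fin n) X x

/-- For an open set `E` of the cube `I^n`, the set `Π(E, X)` of continuous maps `E → X`
that take `E ∩ ∂I^n` to the basepoint `x`. -/
def PartialSpheroid {n : ℕ} (E : Opens (Fin n → I)) (X : Type u) [TopologicalSpace X] (x : X) :
    Type u :=
  {a : C(E, X) // ∀ y : E, (y : Fin n → I) ∈ Cube.boundary (Fin n) → a y = x}

/-- The restriction `a|_E` of a spheroid to an open set of the cube. -/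
def Spheroid.restrict {n : ℕ} {X : Type u} [TopologicalSpace X] {x : X}
    (a : Spheroid n X x) (E : Opens (Fin n → I)) : PartialSpheroid E X x :=
  ⟨a.1.restrict (E : Set (Fin n → I)), fun y hy => a.2 y hy⟩

open Classical in
/-- For a finite family `Γ` of open sets, the finite set `Γ(r)` of all unions of at most `r`
elements of `Γ` (the empty union included). -/
def unionsOfAtMost {n : ℕ} (Γ : Finset (Opens (Fin n → I))) (r : ℕ) :
    Finset (Opens (Fin n → I)) :=
  (Γ.powerset.filter fun S => S.card ≤ r).image fun S => S.sup id

/-- The condition on `r` in the definition of the degree of a functional `f` on `Π_n(X)`: for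
every finite open cover `Γ` of `I^n` there are functionals `f_E` on `Π(E, X)`, `E ∈ Γ(r)`, with
`f(a) = ∑_{E ∈ Γ(r)} f_E(a|_E)` for all spheroids `a`. (Values of `fE` at the open sets
outside `Γ(r)` are not used.) -/
def HasDecompositions {n : ℕ} {X : Type u} [TopologicalSpace X] {x : X} {L : Type v}
    [AddCommGroup L] (f : Spheroid n X x → L) (r : ℕ) : Prop :=
  ∀ Γ : Finset (Opens (Fin n → I)), (∀ y : Fin n → I, ∃ E ∈ Γ, y ∈ E) →
    ∃ fE : (E : Opens (Fin n → I)) → PartialSpheroid E X x → L,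
      ∀ a : Spheroid n X x, f a = ∑ E ∈ unionsOfAtMost Γ r, fE E (Spheroid.restrict a E)

/-- The degree of a functional on `Π_n(X)`: the infimum, in `{0, 1, 2, …, ∞}`, of the numbers
`r` with the property above; it is `∞` when there is no such `r`. -/
def degree {n : ℕ} {X : Type u} [TopologicalSpace X] {x : X} {L : Type v}
    [AddCommGroup L] (f : Spheroid n X x → L) : ℕ∞ :=
  ⨅ (r : ℕ) (_ : HasDecompositions f r), (r : ℕ∞)

/-- A functional on `Π_n(X)` is homotopy invariant if `f(a)` depends only on the class
`[a] ∈ π_n(X)`, i.e. spheroids that are homotopic rel `∂I^n` have equal values. -/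
def HomotopyInvariant {n : ℕ} {X : Type u} [TopologicalSpace X] {x : X} {L : Type v}
    (f : Spheroid n X x → L) : Prop :=
  ∀ a b : Spheroid n X x, GenLoop.Homotopic a b → f a = f b

/-- The standard bijection `Ξ : Π_{m+1}(X) → Π_m(ΩX)`,
`Ξ(a)(t₁, …, t_m)(t) = a(t₁, …, t_m, t)`, where the loop space `ΩX` has the compact-open
topology and the constant loop as its basepoint. -/
def standardBijection (m : ℕ) (X : Type u) [TopologicalSpace X] (x : X) :
    Spheroid (m + 1) X x ≃ Spheroid m (LoopSpace X x) (Path.refl x) where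
  toFun a :=
    ⟨{ toFun := fun s =>
        { toFun := fun t => a (Fin.snoc (α := fun _ => I) s t)
          continuous_toFun := by
            exact a.1.continuous.comp (continuous_const.finSnoc continuous_id)
          source' := a.2 _ ⟨Fin.last m, Or.inl (by simp)⟩
          target' := a.2 _ ⟨Fin.last m, Or.inr (by simp)⟩ }
       continuous_toFun := by
        refine Path.continuous_uncurry_iff.1 ?_
        have h : Continuous fun p : (Fin m → I) × I =>
            (Fin.snoc (α := fun _ => I) p.1 p.2 : Fin (m + 1) → I) :=
          Continuous.finSnoc (A := fun _ => I) continuous_fst continuous_snd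
        exact a.1.continuous.comp h }, by
      rintro s ⟨i, hi⟩
      ext t
      exact a.2 _ ⟨i.castSucc, by simpa using hi⟩⟩
  invFun b :=
    ⟨{ toFun := fun y => b (Fin.init (α := fun _ => I) y) (y (Fin.last m))
       continuous_toFun := by
        have h := Path.continuous_uncurry_iff.2 b.1.continuous
        have h' : Continuous fun y : Fin (m + 1) → I => Fin.init (α := fun _ => I) y :=
          Continuous.finInit (A := fun _ => I) continuous_id
        exact h.comp (h'.prodMk (continuous_apply (Fin.last m))) }, by
      rintro y ⟨i, hi⟩
      change b (Fin.init (α := fun _ => I) y) (y (Fin.last m)) = x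
      induction i using Fin.lastCases with
      | last => rcases hi with h | h <;> rw [h] <;> simp
      | cast i =>
        have h : b (Fin.init (α := fun _ => I) y) = Path.refl x := b.2 _ ⟨i, hi⟩
        rw [h]; rfl⟩
  left_inv a := by
    ext y
    change a (Fin.snoc (α := fun _ => I) (Fin.init (α := fun _ => I) y) (y (Fin.last m))) = a y
    rw [Fin.snoc_init_self]
  right_inv b := by
    ext s t
    change b (Fin.init (α := fun _ => I) (Fin.snoc (α := fun _ => I) s t))
      ((Fin.snoc (α := fun _ => I) s t : Fin (m + 1) → I) (Fin.last m)) = b s t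
    rw [Fin.init_snoc, Fin.snoc_last]

end SpheroidFunctional

end

/-!
The value `g (Ξ a)` may be computed from any spheroid in `ΩX` homotopic to `Ξ a`. For a given open
cover `Γ` of `I ^ (m + 1)`, the idea is to choose this spheroid so that near each `s : I ^ m` its
loops depend only on the restriction of `a` to a union of `m` elements of `Γ`
(`exists_deformation_determined_on_unions`). Such neighbourhoods form an open cover `Δ` of `I ^ m`,
and each term of a decomposition of `g` over `Δ(r)` then becomes a functional of the restriction
of `a` to an element of `Γ(m * r)`.

To construct the deformation, fix a large `N`. The vertical path `u ↦ (s, u)` is replaced by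
`u ↦ (y, u)`, where the coordinate `y i = shear N (s i) u` stays at distance at most `1 / N` from
`s i`, and moves from one multiple of `1 / N` to another only during a time window of length
`1 / N` that depends on `s i`. Thus outside of `m` short windows the path runs inside a vertical
line over a lattice point of `I ^ m`. The loop of `a` over a lattice point is null-homotopic
because `X` is simply connected, and the null-homotopy can be put together from pieces over the
intervals `[j / N, (j + 1) / N]` (`exists_local_nullhomotopy`). Switching these null-homotopies
on over the lattice points (`exists_local_deformation`) makes the loop trivial outside the `m`
windows, while inside a window it depends only on the values of `a` on a small set near one point
of the cube, which lies in one element of `Γ` by the Lebesgue number lemma.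
-/

open TopologicalSpace
open scoped unitInterval

namespace SpheroidFunctional

universe u v

/-! ### Local null-homotopies of loops -/

/-- The nearest-point retraction of the real line onto `I`. -/
noncomputable def clamp : ℝ → I := Set.projIcc 0 1 zero_le_one

@[fun_prop]
lemma continuous_clamp : Continuous clamp := continuous_projIcc

lemma coe_clamp (t : ℝ) : (clamp t : ℝ) = max 0 (min 1 t) := Set.coe_projIcc _ _ _ _

lemma clamp_coe (t : I) : clamp t = t := Set.projIcc_val _ t

lemma clamp_of_le_zero {t : ℝ} (h : t ≤ 0) : clamp t = 0 := Set.projIcc_of_le_left _ h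

lemma clamp_of_one_le {t : ℝ} (h : 1 ≤ t) : clamp t = 1 := Set.projIcc_of_right_le _ h

lemma abs_clamp_sub_le (t : ℝ) (u : I) : |(clamp t : ℝ) - u| ≤ |t - u| := by
  have h := Set.abs_projIcc_sub_projIcc (a := (0 : ℝ)) (b := 1) (c := t) (d := (u : ℝ)) zero_le_one
  rwa [Set.projIcc_val] at h

/-- In a simply connected space, paths can be contracted to `x` with the track of each endpoint
depending on that endpoint alone: `C y` is the track of an endpoint `y`, and `D p` is the
contraction of the path `p`. Both are constant at the basepoint. -/
lemma exists_path_contraction {X : Type u} [TopologicalSpace X] [SimplyConnectedSpace X]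
    (x : X) : ∃ (C : X → I → X) (D : C(I, X) → I → I → X),
      (∀ p, Continuous fun q : I × I => D p q.1 q.2) ∧ (∀ p z, D p 0 z = p z) ∧
      (∀ p z, D p 1 z = x) ∧ (∀ p θ, D p θ 0 = C (p 0) θ) ∧ (∀ p θ, D p θ 1 = C (p 1) θ) ∧
      (∀ θ, C x θ = x) ∧ ∀ θ z, D (ContinuousMap.const I x) θ z = x := by
  classical
  let c : ∀ y : X, Path y x := fun y =>
    if h : y = x then (Path.refl x).cast h rfl else PathConnectedSpace.somePath y x
  have hc : ∀ t, c x t = x := fun t => by simp [c]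
  let C : X → I → X := fun y θ => c y (clamp (2 * θ - 1))
  have hD : ∀ p : C(I, X), ∃ D : I → I → X,
      Continuous (fun q : I × I => D q.1 q.2) ∧ (∀ z, D 0 z = p z) ∧
      (∀ z, D 1 z = x) ∧ (∀ θ, D θ 0 = C (p 0) θ) ∧ (∀ θ, D θ 1 = C (p 1) θ) ∧
      (p = ContinuousMap.const I x → ∀ θ z, D θ z = x) := by
    intro p
    by_cases hp : p = ContinuousMap.const I x
    · subst hp
      exact ⟨fun _ _ => x, continuous_const, fun _ => rfl, fun _ => rfl, fun θ => (hc _).symm,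
        fun θ => (hc _).symm, fun _ _ _ => rfl⟩
    let P : Path (p 0) (p 1) := ⟨p, rfl, rfl⟩
    obtain ⟨S⟩ := SimplyConnectedSpace.paths_homotopic P ((c (p 0)).trans (c (p 1)).symm)
    -- The homotopy `S` ends at the detour through `x`; the slices of `D` first run through `S`
    -- and then shrink to the midpoint of that detour.
    refine ⟨fun θ z => S (clamp (2 * θ), clamp ((1 - clamp (2 * θ - 1)) * z
      + clamp (2 * θ - 1) / 2)), by fun_prop, fun z => ?_, fun z => ?_, fun θ => ?_, fun θ => ?_,
      fun h => absurd h hp⟩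
    · have h1 : clamp (2 * ((0 : I) : ℝ)) = 0 := clamp_of_le_zero (by simp)
      have h2 : clamp (2 * ((0 : I) : ℝ) - 1) = 0 := clamp_of_le_zero (by simp)
      simp only [h1, h2]
      simp [clamp_coe, P]
    · have h1 : clamp (2 * ((1 : I) : ℝ)) = 1 := clamp_of_one_le (by simp)
      have h2 : clamp (2 * ((1 : I) : ℝ) - 1) = 1 := clamp_of_one_le (by norm_num)
      have h3 : (clamp (1 / 2 : ℝ) : ℝ) = 1 / 2 := by rw [coe_clamp]; norm_num
      simp only [h1, h2]
      simp only [Set.Icc.coe_one, sub_self, zero_mul, zero_add, ContinuousMap.HomotopyWith.apply_one]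
      change ((c (p 0)).trans (c (p 1)).symm) _ = x
      rw [Path.trans_apply, dif_pos h3.le]
      convert (c (p 0)).target using 2
      ext
      simp only [h3]
      norm_num
    · rcases le_total (2 * (θ : ℝ) - 1) 0 with h | h
      · simp only [C, clamp_of_le_zero h]
        have h1 : clamp ((1 - ((0 : I) : ℝ)) * ((0 : I) : ℝ) + ((0 : I) : ℝ) / 2) = 0 :=
          clamp_of_le_zero (by simp)
        rw [h1]
        simp [P]
      · have h1 : clamp (2 * (θ : ℝ)) = 1 := clamp_of_one_le (by linarith)
        simp only [C, h1]
        set k := clamp (2 * (θ : ℝ) - 1)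
        have hk0 := k.2.1
        have hk1 := k.2.2
        have h3 : (clamp ((1 - (k : ℝ)) * ((0 : I) : ℝ) + (k : ℝ) / 2) : ℝ) = k / 2 := by
          rw [coe_clamp, Set.Icc.coe_zero, mul_zero, zero_add, min_eq_right (by linarith),
            max_eq_right (by linarith)]
        erw [S.apply_one]
        change ((c (p 0)).trans (c (p 1)).symm) _ = _
        rw [Path.trans_apply, dif_pos (by rw [h3]; linarith)]
        congr 1
        ext
        simp only [h3]
        ring
    · rcases le_total (2 * (θ : ℝ) - 1) 0 with h | h
      · simp only [C, clamp_of_le_zero h]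
        have h1 : clamp ((1 - ((0 : I) : ℝ)) * ((1 : I) : ℝ) + ((0 : I) : ℝ) / 2) = 1 :=
          clamp_of_one_le (by simp)
        rw [h1]
        simp [P]
      · have h1 : clamp (2 * (θ : ℝ)) = 1 := clamp_of_one_le (by linarith)
        simp only [C, h1]
        set k := clamp (2 * (θ : ℝ) - 1)
        have hk0 := k.2.1
        have hk1 := k.2.2
        have h3 : (clamp ((1 - (k : ℝ)) * ((1 : I) : ℝ) + (k : ℝ) / 2) : ℝ) = 1 - k / 2 := by
          rw [coe_clamp, Set.Icc.coe_one, mul_one, min_eq_right (by linarith),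
            max_eq_right (by linarith)]
          ring
        erw [S.apply_one]
        change ((c (p 0)).trans (c (p 1)).symm) _ = _
        have hsymm : ∀ w, ((c (p 0)).trans (c (p 1)).symm) w
            = ((c (p 1)).trans (c (p 0)).symm) (unitInterval.symm w) := fun w => by
          rw [← Path.symm_symm (c (p 0)), ← Path.trans_symm, Path.symm_symm, Path.symm_apply,
            Function.comp_apply]
        rw [hsymm, Path.trans_apply, dif_pos (by rw [unitInterval.coe_symm_eq, h3]; linarith)]
        congr 1
        ext
        simp only [unitInterval.coe_symm_eq, h3]
        ring
  choose D h1 h2 h3 h4 h5 h6 using hD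
  exact ⟨C, D, h1, h2, h3, h4, h5, fun θ => hc _, h6 _ rfl⟩

/-- In a simply connected space, the loops at `x` have null-homotopies rel endpoints that are
local at the scale `1 / N`: the track of the point at time `u` depends only on the part of the
loop over the times at distance at most `1 / N` from `u`. -/
lemma exists_local_nullhomotopy {X : Type u} [TopologicalSpace X] [SimplyConnectedSpace X]
    (x : X) {N : ℕ} (hN : 0 < N) : ∃ G : Path x x → I → I → X,
      (∀ ω, Continuous fun q : I × I => G ω q.1 q.2) ∧ (∀ ω u, G ω 0 u = ω u) ∧
      (∀ ω u, G ω 1 u = x) ∧ (∀ ω θ, G ω θ 0 = x) ∧ (∀ ω θ, G ω θ 1 = x) ∧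
      (∀ θ u, G (Path.refl x) θ u = x) ∧
      ∀ (ω ω' : Path x x) (u : I),
        (∀ u' : I, |(u' : ℝ) - u| ≤ 1 / N → ω u' = ω' u') → ∀ θ, G ω θ u = G ω' θ u := by
  obtain ⟨C, D, hDc, hD0, hD1, hDl, hDr, hC, hDx⟩ := exists_path_contraction x
  have hN' : (0 : ℝ) < N := by exact_mod_cast hN
  -- `seg j` parametrizes the interval from `j / N` to `(j + 1) / N`; for `j = N` it is constant.
  let seg : ℕ → C(I, I) := fun j => ⟨fun z => clamp ((j + z) / N), by fun_prop⟩
  have hseg : ∀ (j : ℕ) (z : I), seg j z = clamp ((j + z) / N) := fun _ _ => rfl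
  let G : Path x x → I → I → X := fun ω θ u =>
    D (ω.toContinuousMap.comp (seg ⌊(N : ℝ) * u⌋₊)) θ (clamp (N * u - ⌊(N : ℝ) * u⌋₊))
  have hnn : ∀ u : I, 0 ≤ (N : ℝ) * u := fun u => mul_nonneg hN'.le u.2.1
  have hfl : ∀ u : I, seg ⌊(N : ℝ) * u⌋₊ (clamp (N * u - ⌊(N : ℝ) * u⌋₊)) = u := fun u => by
    have h1 := Nat.floor_le (hnn u)
    have h2 := Nat.lt_floor_add_one ((N : ℝ) * u)
    rw [hseg, coe_clamp, min_eq_right (by linarith), max_eq_right (by linarith)]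
    rw [add_sub_cancel, mul_div_cancel_left₀ _ hN'.ne', clamp_coe]
  have hend : ∀ ω u, (u : I) = 0 ∨ u = 1 → ∀ θ, G ω θ u = x := by
    intro ω u hu θ
    have h0 : (N : ℝ) * u - ⌊(N : ℝ) * u⌋₊ = 0 := by rcases hu with rfl | rfl <;> simp
    have h1 := hfl u
    simp only [G]
    rw [h0, clamp_of_le_zero le_rfl] at h1 ⊢
    rw [hDl]
    change C (ω (seg _ 0)) θ = x
    rw [h1]
    rcases hu with rfl | rfl <;> simp [hC]
  refine ⟨G, fun ω => ?_, fun ω u => ?_, fun ω u => hD1 _ _, fun ω => hend ω 0 (Or.inl rfl),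
    fun ω => hend ω 1 (Or.inr rfl), fun θ u => ?_, fun ω ω' u h θ => ?_⟩
  · refine (locallyFinite_of_finite fun j : Fin (N + 1) =>
      {q : I × I | (j : ℝ) ≤ N * q.2 ∧ (N : ℝ) * q.2 ≤ j + 1}).continuous ?_ ?_ ?_
    · refine Set.eq_univ_of_forall fun q => Set.mem_iUnion.2 ?_
      refine ⟨⟨⌊(N : ℝ) * q.2⌋₊, ?_⟩, Nat.floor_le (hnn _), (Nat.lt_floor_add_one _).le⟩
      refine Nat.lt_succ_of_le (Nat.floor_le_of_le ?_)
      nlinarith [q.2.2.2]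
    · intro j
      have h : Continuous fun q : I × I => (N : ℝ) * q.2 := by fun_prop
      exact (isClosed_le continuous_const h).inter (isClosed_le h continuous_const)
    · intro j
      have hcont : Continuous fun q : I × I =>
          D (ω.toContinuousMap.comp (seg j)) q.1 (clamp (N * q.2 - j)) :=
        (hDc (ω.toContinuousMap.comp (seg j))).comp
          (f := fun q : I × I => (q.1, clamp (N * q.2 - j))) (by fun_prop)
      refine hcont.continuousOn.congr fun q hq => ?_
      obtain ⟨h1, h2⟩ := hq
      rcases h2.lt_or_eq with h2 | h2
      · have : ⌊(N : ℝ) * q.2⌋₊ = (j : ℕ) := (Nat.floor_eq_iff (hnn _)).2 ⟨h1, h2⟩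
        simp only [G, this]
      · have : ⌊(N : ℝ) * q.2⌋₊ = (j : ℕ) + 1 := by
          rw [h2]; exact_mod_cast Nat.floor_natCast ((j : ℕ) + 1)
        simp only [G, this]
        rw [clamp_of_le_zero (by push_cast; linarith), clamp_of_one_le (by linarith), hDl, hDr]
        change C (ω (seg _ 0)) _ = C (ω (seg _ 1)) _
        simp [hseg]
  · simp only [G, hD0]
    change ω (seg _ _) = ω u
    rw [hfl]
  · simp only [G]
    exact hDx θ _
  · simp only [G]
    congr 1
    ext z
    refine h _ ?_
    refine (abs_clamp_sub_le _ _).trans ?_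
    have h1 := Nat.floor_le (hnn u)
    have h2 := Nat.lt_floor_add_one ((N : ℝ) * u)
    have h3 : ((⌊(N : ℝ) * u⌋₊ : ℝ) + z) / N - u = (⌊(N : ℝ) * u⌋₊ + z - N * u) / N := by
      field_simp
    rw [h3, abs_div, abs_of_pos hN']
    refine div_le_div_of_nonneg_right (abs_le.2 ⟨?_, ?_⟩) hN'.le
    · linarith [z.2.1]
    · linarith [z.2.2]

/-! ### Pushing the vertical lines of the cube into the lines over a lattice -/

/-- The progress at time `u` of the step from `l / N` to `(l + 1) / N` for the coordinate `ξ`: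
the step has not begun where this is `≤ 0`, and it is complete where this is `≥ 1`. -/
noncomputable def phase (N l : ℕ) (ξ u : I) : ℝ := (N + 1) * (N * ξ - l) - N * u

/-- The coordinate `ξ` displaced by at most `1 / N`, in such a way that for fixed `ξ` it is a
multiple of `1 / N` for all times `u` outside an interval of length less than `1 / N`. -/
noncomputable def shear (N : ℕ) (ξ u : I) : I :=
  clamp ((∑ l ∈ Finset.range N, (clamp (3 * phase N l ξ u - 1) : ℝ)) / N)

/-- A cut-off function: it vanishes unless `shear N ξ u` is a multiple of `1 / N`, and it is `1`
unless some step is in progress. -/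
noncomputable def weight (N : ℕ) (ξ u : I) : I :=
  ∏ l ∈ Finset.range N, clamp (6 * |phase N l ξ u - 1 / 2| - 1)

@[fun_prop]
lemma continuous_phase (N l : ℕ) : Continuous fun q : I × I => phase N l q.1 q.2 := by
  unfold phase; fun_prop

@[fun_prop]
lemma continuous_shear (N : ℕ) : Continuous fun q : I × I => shear N q.1 q.2 := by
  unfold shear
  refine continuous_clamp.comp (Continuous.div_const (continuous_finsetSum _ fun l _ => ?_) _)
  have := continuous_phase N l
  fun_prop

@[fun_prop]
lemma continuous_weight (N : ℕ) : Continuous fun q : I × I => weight N q.1 q.2 := by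
  unfold weight
  refine continuous_finsetProd _ fun l _ => ?_
  have := continuous_phase N l
  fun_prop

lemma phase_le_zero {N l : ℕ} {ξ : I} (h : (N : ℝ) * ξ ≤ l) (u : I) : phase N l ξ u ≤ 0 := by
  have h1 : 0 ≤ (N : ℝ) * u := mul_nonneg N.cast_nonneg u.2.1
  have h2 : (N + 1 : ℝ) * (N * ξ - l) ≤ 0 :=
    mul_nonpos_of_nonneg_of_nonpos (by positivity) (by linarith)
  unfold phase
  linarith

lemma one_le_phase {N l : ℕ} {ξ : I} (h : (l : ℝ) + 1 ≤ N * ξ) (u : I) : 1 ≤ phase N l ξ u := by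
  have h1 : (N : ℝ) * u ≤ N := mul_le_of_le_one_right N.cast_nonneg u.2.2
  have h2 : (N + 1 : ℝ) * 1 ≤ (N + 1 : ℝ) * (N * ξ - l) :=
    mul_le_mul_of_nonneg_left (by linarith) (by positivity)
  unfold phase
  linarith

lemma shear_zero (N : ℕ) (u : I) : shear N 0 u = 0 := by
  unfold shear
  refine clamp_of_le_zero ?_
  rw [Finset.sum_eq_zero, zero_div]
  intro l _
  have := phase_le_zero (N := N) (l := l) (ξ := 0) (by simp) u
  rw [clamp_of_le_zero (by linarith), Set.Icc.coe_zero]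

lemma shear_one {N : ℕ} (hN : 0 < N) (u : I) : shear N 1 u = 1 := by
  unfold shear
  have hN' : (N : ℝ) ≠ 0 := by exact_mod_cast hN.ne'
  refine clamp_of_one_le ?_
  rw [Finset.sum_congr rfl (g := fun _ => (1 : ℝ)), Finset.sum_const, Finset.card_range,
    nsmul_eq_mul, mul_one, div_self hN']
  intro l hl
  have hl' : (l : ℝ) + 1 ≤ N := by exact_mod_cast Finset.mem_range.1 hl
  have := one_le_phase (N := N) (l := l) (ξ := 1) (by simpa using hl') u
  rw [clamp_of_one_le (by linarith), Set.Icc.coe_one]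

lemma abs_shear_sub_le {N : ℕ} (hN : 0 < N) (ξ u : I) : |(shear N ξ u : ℝ) - ξ| ≤ 1 / N := by
  have hN' : (0 : ℝ) < N := by exact_mod_cast hN
  refine (abs_clamp_sub_le _ _).trans ?_
  have hξ : 0 ≤ (N : ℝ) * ξ := mul_nonneg hN'.le ξ.2.1
  set k := ⌊(N : ℝ) * ξ⌋₊
  have hk1 : (k : ℝ) ≤ N * ξ := Nat.floor_le hξ
  have hk2 : (N : ℝ) * ξ < k + 1 := Nat.lt_floor_add_one _
  have hkN : k ≤ N := Nat.floor_le_of_le (mul_le_of_le_one_right hN'.le ξ.2.2)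
  set f : ℕ → ℝ := fun l => (clamp (3 * phase N l ξ u - 1) : ℝ)
  -- The steps before the `k`-th are complete, those after it have not begun.
  have hlow : (k : ℝ) ≤ ∑ l ∈ Finset.range N, f l := by
    have h1 : ∑ l ∈ Finset.range k, f l = k := by
      rw [Finset.sum_congr rfl (g := fun _ => (1 : ℝ))]
      · simp
      · intro l hl
        have hl' : (l : ℝ) + 1 ≤ k := by exact_mod_cast Finset.mem_range.1 hl
        have := one_le_phase (N := N) (l := l) (ξ := ξ) (hl'.trans hk1) u
        simp only [f]
        rw [clamp_of_one_le (by linarith), Set.Icc.coe_one]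
    rw [← h1]
    exact Finset.sum_le_sum_of_subset_of_nonneg (Finset.range_mono hkN) fun l _ _ => (clamp _).2.1
  have hupp : ∑ l ∈ Finset.range N, f l ≤ k + 1 := by
    have h1 : ∑ l ∈ Finset.range N, f l ≤
        ∑ l ∈ Finset.range N, if l < k + 1 then (1 : ℝ) else 0 := by
      refine Finset.sum_le_sum fun l _ => ?_
      split_ifs with hl
      · exact (clamp _).2.2
      · have hl' : (k : ℝ) + 1 ≤ l := by exact_mod_cast not_lt.1 hl
        have := phase_le_zero (N := N) (l := l) (ξ := ξ) (by linarith) u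
        simp only [f]
        rw [clamp_of_le_zero (by linarith), Set.Icc.coe_zero]
    refine h1.trans ?_
    rw [← Finset.sum_filter, Finset.sum_const, nsmul_eq_mul, mul_one]
    have : ((Finset.range N).filter (· < k + 1)).card ≤ (Finset.range (k + 1)).card :=
      Finset.card_le_card fun l hl => Finset.mem_range.2 (Finset.mem_filter.1 hl).2
    rw [Finset.card_range] at this
    exact_mod_cast this
  have h3 : (∑ l ∈ Finset.range N, f l) / N - ξ = (∑ l ∈ Finset.range N, f l - N * ξ) / N := by
    field_simp
  rw [h3, abs_div, abs_of_pos hN']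
  exact div_le_div_of_nonneg_right (abs_le.2 ⟨by linarith, by linarith⟩) hN'.le

lemma exists_shear_eq_of_weight_ne_zero {N : ℕ} {ξ u : I} (h : weight N ξ u ≠ 0) :
    ∃ k : Fin (N + 1), shear N ξ u = clamp ((k : ℝ) / N) := by
  have h1 : ∀ l ∈ Finset.range N, ∃ e : ℕ, e ≤ 1 ∧ (clamp (3 * phase N l ξ u - 1) : ℝ) = e := by
    intro l hl
    have h2 : 0 < 6 * |phase N l ξ u - 1 / 2| - 1 := by
      by_contra h3
      exact h (Finset.prod_eq_zero hl (clamp_of_le_zero (not_lt.1 h3)))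
    rcases lt_abs.1 (show 1 / 6 < |phase N l ξ u - 1 / 2| by linarith) with h3 | h3
    · exact ⟨1, le_rfl, by rw [clamp_of_one_le (by linarith)]; simp⟩
    · exact ⟨0, zero_le_one, by rw [clamp_of_le_zero (by linarith)]; simp⟩
  choose! e he1 he2 using h1
  refine ⟨⟨∑ l ∈ Finset.range N, e l, Nat.lt_succ_of_le ?_⟩, ?_⟩
  · simpa using Finset.sum_le_sum he1
  · unfold shear
    rw [Finset.sum_congr rfl he2]
    simp

/-- The times at which the weight at `ξ` differs from `1` lie in a window around a single time
`w`, since only one step is ever in progress over `ξ`. -/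
lemma exists_window (N : ℕ) (ξ : I) : ∃ w : I, ∀ u : I, 1 / (N : ℝ) ≤ |(u : ℝ) - w| →
    ∀ l < N, phase N l ξ u ≤ 0 ∨ 1 ≤ phase N l ξ u := by
  by_cases h : ∃ (w : I) (l : ℕ), l < N ∧ 0 < phase N l ξ w ∧ phase N l ξ w < 1
  · obtain ⟨w, l₀, hl₀, h0, h1⟩ := h
    have hN' : (0 : ℝ) < N := by exact_mod_cast (Nat.zero_le _).trans_lt hl₀
    refine ⟨w, fun u hu l _ => ?_⟩
    have hx0 : (l₀ : ℝ) < N * ξ := by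
      by_contra hx
      exact absurd (phase_le_zero (not_lt.1 hx) w) (not_le.2 h0)
    have hx1 : (N : ℝ) * ξ < l₀ + 1 := by
      by_contra hx
      exact absurd (one_le_phase (not_lt.1 hx) w) (not_le.2 h1)
    rcases lt_trichotomy l l₀ with hl | rfl | hl
    · have : (l : ℝ) + 1 ≤ l₀ := by exact_mod_cast hl
      exact Or.inr (one_le_phase (by linarith) u)
    · have h2 : phase N l ξ u = phase N l ξ w - N * ((u : ℝ) - w) := by unfold phase; ring
      rw [div_le_iff₀ hN'] at hu
      rcases le_total 0 ((u : ℝ) - w) with hs | hs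
      · rw [abs_of_nonneg hs] at hu
        left; linarith
      · rw [abs_of_nonpos hs] at hu
        right; linarith
    · have : (l₀ : ℝ) + 1 ≤ l := by exact_mod_cast hl
      exact Or.inl (phase_le_zero (by linarith) u)
  · push Not at h
    refine ⟨0, fun u _ l hl => ?_⟩
    rcases le_or_gt (phase N l ξ u) 0 with h' | h'
    · exact Or.inl h'
    · exact Or.inr (h u l hl h')

/-! ### The deformation of spheroids in the loop space -/

/-- Null-homotopies `G` chosen loop by loop need not depend continuously on the loop, but a
composite is continuous if the loop only varies where the homotopy parameter is `0` or stays in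
a finite set. -/
lemma continuous_nullhomotopy_comp {X : Type u} [TopologicalSpace X] {x : X}
    {G : Path x x → I → I → X} (hGc : ∀ ω, Continuous fun q : I × I => G ω q.1 q.2)
    (hG0 : ∀ ω u, G ω 0 u = ω u) {S T : Type*} [TopologicalSpace S] [T1Space S]
    [TopologicalSpace T] {c : S → Path x x} (hc : Continuous c) {y : T → S} (hy : Continuous y)
    {b u : T → I} (hb : Continuous b) (hu : Continuous u) {V : Set S} (hV : V.Finite)
    (hbV : ∀ t, b t ≠ 0 → y t ∈ V) : Continuous fun t => G (c (y t)) (b t) (u t) := by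
  have := hV.to_subtype
  refine (locallyFinite_of_finite fun v : Option V =>
    v.elim {t | b t = 0} fun v => {t | y t = v}).continuous ?_ ?_ ?_
  · refine Set.eq_univ_of_forall fun t => Set.mem_iUnion.2 ?_
    by_cases h : b t = 0
    · exact ⟨none, h⟩
    · exact ⟨some ⟨y t, hbV t h⟩, rfl⟩
  · rintro (_ | v)
    · exact isClosed_singleton.preimage hb
    · exact isClosed_singleton.preimage hy
  · rintro (_ | v)
    · have h : Continuous fun t => c (y t) (u t) :=
        (Path.continuous_uncurry_iff.2 hc).comp (hy.prodMk hu)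
      refine h.continuousOn.congr fun t ht => ?_
      have ht' : b t = 0 := ht
      change G (c (y t)) (b t) (u t) = _
      rw [ht', hG0]
    · have h : Continuous fun t => G (c v) (b t) (u t) :=
        (hGc (c v)).comp (f := fun t => (b t, u t)) (hb.prodMk hu)
      refine h.continuousOn.congr fun t ht => ?_
      have ht' : y t = v := ht
      change G (c (y t)) (b t) (u t) = _
      rw [ht']

/-- Every spheroid in the loop space is homotopic to one that is trivial at the points and times
of weight `1`, and that depends elsewhere only on nearby values of the given spheroid. -/
lemma exists_local_deformation {X : Type u} [TopologicalSpace X] [SimplyConnectedSpace X]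
    (x : X) (m : ℕ) {N : ℕ} (hN : 0 < N) :
    ∃ Φ : Spheroid m (LoopSpace X x) (Path.refl x) → Spheroid m (LoopSpace X x) (Path.refl x),
      (∀ c, GenLoop.Homotopic c (Φ c)) ∧
      (∀ c s u, (∀ i, weight N (s i) u = 1) → Φ c s u = x) ∧
      ∀ (c c' : Spheroid m (LoopSpace X x) (Path.refl x)) (s : Fin m → I) (u : I),
        (∀ (s' : Fin m → I) (u' : I), (∀ i, |(s' i : ℝ) - s i| ≤ 1 / N) →
          |(u' : ℝ) - u| ≤ 1 / N → c s' u' = c' s' u') → Φ c s u = Φ c' s u := by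
  obtain ⟨G, hGc, hG0, hG1, hGl, hGr, hGx, hGloc⟩ := exists_local_nullhomotopy x hN
  -- During the first half of the homotopy, `y` moves from the identity to the shear; during the
  -- second half, the null-homotopies over the lattice points are switched on.
  let y : I → (Fin m → I) → I → Fin m → I := fun r s u i =>
    clamp ((1 - clamp (2 * r)) * s i + clamp (2 * r) * shear N (s i) u)
  let b : I → (Fin m → I) → I → I := fun r s u => clamp (2 * r - 1) * ∏ i, weight N (s i) u
  have hshear : ∀ i : Fin m, Continuous fun t : (I × (Fin m → I)) × I =>
      shear N (t.1.2 i) t.2 := fun i =>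
    (continuous_shear N).comp (f := fun t : (I × (Fin m → I)) × I => (t.1.2 i, t.2))
      (by fun_prop)
  have hweight : ∀ i : Fin m, Continuous fun t : (I × (Fin m → I)) × I =>
      weight N (t.1.2 i) t.2 := fun i =>
    (continuous_weight N).comp (f := fun t : (I × (Fin m → I)) × I => (t.1.2 i, t.2))
      (by fun_prop)
  have hyc : Continuous fun t : (I × (Fin m → I)) × I => y t.1.1 t.1.2 t.2 :=
    continuous_pi fun i => by
      have := hshear i
      fun_prop
  have hbc : Continuous fun t : (I × (Fin m → I)) × I => b t.1.1 t.1.2 t.2 :=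
    Continuous.mul (by fun_prop) (continuous_finsetProd _ fun i _ => hweight i)
  let V : Set (Fin m → I) :=
    {p | ∀ i, p i ∈ Set.range fun k : Fin (N + 1) => clamp ((k : ℝ) / N)}
  have hV : V.Finite := Set.Finite.pi' fun i => Set.finite_range _
  have hbV : ∀ t : (I × (Fin m → I)) × I, b t.1.1 t.1.2 t.2 ≠ 0 → y t.1.1 t.1.2 t.2 ∈ V := by
    rintro ⟨⟨r, s⟩, u⟩ h i
    have hr : 1 ≤ 2 * (r : ℝ) := by
      by_contra hr
      refine h ?_
      change clamp (2 * r - 1) * _ = 0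
      rw [clamp_of_le_zero (by linarith), zero_mul]
    have hw : weight N (s i) u ≠ 0 := fun hw => by
      refine h ?_
      change clamp (2 * r - 1) * _ = 0
      rw [Finset.prod_eq_zero (Finset.mem_univ i) hw, mul_zero]
    obtain ⟨k, hk⟩ := exists_shear_eq_of_weight_ne_zero hw
    refine ⟨k, ?_⟩
    change _ = clamp ((1 - clamp (2 * r)) * s i + clamp (2 * r) * shear N (s i) u)
    rw [clamp_of_one_le hr, Set.Icc.coe_one, sub_self, zero_mul, zero_add, one_mul, clamp_coe, hk]
  have hybd : ∀ r s u, s ∈ Cube.boundary (Fin m) → y r s u ∈ Cube.boundary (Fin m) := by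
    rintro r s u ⟨i, hi | hi⟩
    · refine ⟨i, Or.inl ?_⟩
      simp only [y, hi, shear_zero]
      exact clamp_of_le_zero (by simp)
    · refine ⟨i, Or.inr ?_⟩
      simp only [y, hi, shear_one hN]
      exact clamp_of_one_le (by simp)
  let H : Spheroid m (LoopSpace X x) (Path.refl x) → I → (Fin m → I) → Path x x :=
    fun c r s =>
    { toFun := fun u => G (c (y r s u)) (b r s u) u
      continuous_toFun :=
        (continuous_nullhomotopy_comp hGc hG0 c.1.continuous hyc hbc continuous_snd hV hbV).comp
          (f := fun u : I => ((r, s), u)) (by fun_prop)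
      source' := hGl _ _
      target' := hGr _ _ }
  have hHc : ∀ c, Continuous fun q : I × (Fin m → I) => H c q.1 q.2 := fun c =>
    Path.continuous_uncurry_iff.1
      (continuous_nullhomotopy_comp hGc hG0 c.1.continuous hyc hbc continuous_snd hV hbV)
  have hHbd : ∀ c r s, s ∈ Cube.boundary (Fin m) → H c r s = Path.refl x := by
    intro c r s hs
    ext u
    change G (c (y r s u)) (b r s u) u = x
    have hc : c (y r s u) = Path.refl x := c.2 _ (hybd r s u hs)
    rw [hc, hGx]
  let Φ : Spheroid m (LoopSpace X x) (Path.refl x) → Spheroid m (LoopSpace X x) (Path.refl x) :=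
    fun c => ⟨⟨fun s => H c 1 s, (hHc c).comp (f := fun s => ((1 : I), s)) (by fun_prop)⟩,
      fun s hs => hHbd c 1 s hs⟩
  have hΦ : ∀ c s u, Φ c s u = G (c fun i => shear N (s i) u) (∏ i, weight N (s i) u) u := by
    intro c s u
    change G (c (y 1 s u)) (b 1 s u) u = _
    have h1 : clamp (2 * ((1 : I) : ℝ)) = 1 := clamp_of_one_le (by simp)
    have h2 : clamp (2 * ((1 : I) : ℝ) - 1) = 1 := clamp_of_one_le (by norm_num)
    simp only [y, b, h1, h2]
    simp [clamp_coe]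
  refine ⟨Φ, fun c => ⟨⟨⟨⟨fun q => H c q.1 q.2, hHc c⟩, fun s => ?_, fun s => rfl⟩,
    fun r s hs => ?_⟩⟩, fun c s u h => ?_, fun c c' s u h => ?_⟩
  · ext u
    change G (c (y 0 s u)) (b 0 s u) u = c s u
    have h1 : clamp (2 * ((0 : I) : ℝ)) = 0 := clamp_of_le_zero (by simp)
    have h2 : clamp (2 * ((0 : I) : ℝ) - 1) = 0 := clamp_of_le_zero (by simp)
    simp only [y, b, h1, h2]
    simp [clamp_coe, hG0]
  · exact (hHbd c r s hs).trans (c.2 s hs).symm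
  · rw [hΦ, Finset.prod_eq_one fun i _ => h i, hG1]
  · rw [hΦ, hΦ]
    exact hGloc _ _ _ (fun u' hu' => h _ _ (fun i => abs_shear_sub_le hN _ _) hu') _

/-! ### Decompositions of composites with the standard bijection -/

/-- For a given open cover `Γ` of the cube `I ^ (m + 1)`, the image of `a` under the standard
bijection can be deformed so that, near each point of `I ^ m`, the result depends only on the
restriction of `a` to the union of at most `m` elements of `Γ`. -/
lemma exists_deformation_determined_on_unions {X : Type u} [TopologicalSpace X]
    [SimplyConnectedSpace X] (x : X) {m : ℕ} (Γ : Finset (Opens (Fin (m + 1) → I)))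
    (hΓ : ∀ y : Fin (m + 1) → I, ∃ E ∈ Γ, y ∈ E) :
    ∃ Φ : Spheroid m (LoopSpace X x) (Path.refl x) → Spheroid m (LoopSpace X x) (Path.refl x),
      (∀ c, GenLoop.Homotopic c (Φ c)) ∧
      ∀ s₀ : Fin m → I, ∃ U : Opens (Fin m → I), s₀ ∈ U ∧
        ∃ T ⊆ Γ, T.card ≤ m ∧ ∀ a a' : Spheroid (m + 1) X x, (∀ p ∈ T.sup id, a p = a' p) →
          ∀ s ∈ U, Φ (standardBijection m X x a) s = Φ (standardBijection m X x a') s := by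
  classical
  obtain ⟨δ, hδ, hball⟩ := lebesgue_number_lemma_of_metric (s := (Set.univ : Set (Fin (m + 1) → I)))
    (c := fun E : Γ => ((E : Opens (Fin (m + 1) → I)) : Set (Fin (m + 1) → I))) isCompact_univ
    (fun E => E.1.isOpen) fun y _ => by
      obtain ⟨E, hE, hy⟩ := hΓ y
      exact Set.mem_iUnion.2 ⟨⟨E, hE⟩, hy⟩
  obtain ⟨n, hn⟩ := exists_nat_one_div_lt (show 0 < δ / 2 by positivity)
  obtain ⟨N, hN, hNδ⟩ : ∃ N : ℕ, 0 < N ∧ 1 / (N : ℝ) < δ / 2 :=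
    ⟨n + 1, n.succ_pos, by exact_mod_cast hn⟩
  have hN' : 0 < 1 / (N : ℝ) := by positivity
  obtain ⟨Φ, hΦh, hΦ1, hΦloc⟩ := exists_local_deformation x m hN
  refine ⟨Φ, hΦh, fun s₀ => ?_⟩
  choose w hw using fun i => exists_window N (s₀ i)
  choose E hE using fun i => hball (Fin.snoc (α := fun _ => I) s₀ (w i)) (Set.mem_univ _)
  -- Outside the windows over `s₀`, no step is in progress at `s₀`, so that the weights are `1`
  -- over a whole neighbourhood of `s₀`.
  let O : Set ((Fin m → I) × I) := {q | ∀ i, ∀ l : Fin N,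
    phase N l (q.1 i) q.2 < 1 / 6 ∨ 5 / 6 < phase N l (q.1 i) q.2}
  have hO : IsOpen O := by
    have : O = ⋂ i, ⋂ l : Fin N, ({q | phase N l (q.1 i) q.2 < 1 / 6} ∪
        {q | 5 / 6 < phase N l (q.1 i) q.2}) := by
      ext q; simp [O]
    rw [this]
    refine isOpen_iInter_of_finite fun i => isOpen_iInter_of_finite fun l => ?_
    have hc : Continuous fun q : (Fin m → I) × I => phase N l (q.1 i) q.2 :=
      (continuous_phase N l).comp (f := fun q : (Fin m → I) × I => (q.1 i, q.2)) (by fun_prop)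
    exact (isOpen_lt hc continuous_const).union (isOpen_lt continuous_const hc)
  let K : Set I := {u | ∀ i, 1 / (N : ℝ) ≤ |(u : ℝ) - w i|}
  have hK : IsCompact K := by
    have : K = ⋂ i, {u : I | 1 / (N : ℝ) ≤ |(u : ℝ) - w i|} := by
      ext u; simp [K]
    rw [this]
    refine (isClosed_iInter fun i => ?_).isCompact
    exact isClosed_le continuous_const (by fun_prop)
  obtain ⟨U, U', hU, -, hsU, hKU', hUO⟩ := generalized_tube_lemma (isCompact_singleton (x := s₀))
    hK hO (by
      rintro ⟨s, u⟩ ⟨rfl, hu⟩ i l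
      rcases hw i u (hu i) l l.2 with h | h
      · left; linarith
      · right; linarith)
  refine ⟨⟨U ∩ Metric.ball s₀ (1 / N), hU.inter Metric.isOpen_ball⟩,
    ⟨hsU rfl, Metric.mem_ball_self hN'⟩, Finset.univ.image fun i => (E i : Opens _), ?_, ?_, ?_⟩
  · intro F hF
    obtain ⟨i, -, rfl⟩ := Finset.mem_image.1 hF
    exact (E i).2
  · exact Finset.card_image_le.trans (by simp)
  · rintro a a' haa' s ⟨hsU', hsb⟩
    ext u
    by_cases hu : u ∈ K
    · have h1 : ∀ i, weight N (s i) u = 1 := fun i => Finset.prod_eq_one fun l hl => by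
        refine clamp_of_one_le ?_
        have h2 : 1 / 3 < |phase N l (s i) u - 1 / 2| := by
          rcases hUO (Set.mk_mem_prod hsU' (hKU' hu)) i ⟨l, Finset.mem_range.1 hl⟩ with h | h
          · exact lt_abs.2 (Or.inr (by simp only at h; linarith))
          · exact lt_abs.2 (Or.inl (by simp only at h; linarith))
        linarith
      rw [hΦ1 _ s u h1, hΦ1 _ s u h1]
    · obtain ⟨i, hi⟩ := not_forall.1 hu
      rw [not_le] at hi
      refine hΦloc _ _ s u fun s' u' hs' hu' => ?_
      change a (Fin.snoc (α := fun _ => I) s' u') = a' (Fin.snoc (α := fun _ => I) s' u')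
      refine haa' _ ?_
      have hle : (E i : Opens (Fin (m + 1) → I)) ≤
          (Finset.univ.image fun i => (E i : Opens (Fin (m + 1) → I))).sup id :=
        Finset.le_sup (f := id) (Finset.mem_image_of_mem _ (Finset.mem_univ i))
      refine hle (hE i ?_)
      rw [Metric.mem_ball, dist_pi_lt_iff hδ]
      intro j
      induction j using Fin.lastCases with
      | last =>
        rw [Fin.snoc_last, Fin.snoc_last, Subtype.dist_eq, Real.dist_eq]
        have := abs_sub_le (u' : ℝ) u (w i)
        linarith
      | cast j =>
        rw [Fin.snoc_castSucc, Fin.snoc_castSucc, Subtype.dist_eq, Real.dist_eq]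
        have h1 := abs_sub_le (s' j : ℝ) (s j) (s₀ j)
        have h2 := (dist_le_pi_dist s s₀ j).trans_lt (Metric.mem_ball.1 hsb)
        rw [Subtype.dist_eq, Real.dist_eq] at h2
        have h3 := hs' j
        linarith

lemma mem_unionsOfAtMost {n : ℕ} {Γ : Finset (Opens (Fin n → I))} {r : ℕ}
    {W : Opens (Fin n → I)} :
    W ∈ unionsOfAtMost Γ r ↔ ∃ S ⊆ Γ, S.card ≤ r ∧ S.sup id = W := by
  simp [unionsOfAtMost, and_assoc]

/-- Here `t.image U` is the cover `Δ` of `I ^ m`, and the functional on an open set `F` collects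
the terms of `g` over all `W` in `Δ(r)` that are determined on `F`. On a partial spheroid that is
not the restriction of a spheroid, its value does not matter and is set to `0`. -/
lemma HasDecompositions.comp_standardBijection {m : ℕ} {X : Type u} [TopologicalSpace X]
    [SimplyConnectedSpace X] {x : X} {L : Type v} [AddCommGroup L]
    {g : Spheroid m (LoopSpace X x) (Path.refl x) → L} (hg : HomotopyInvariant g) {r : ℕ}
    (hr : HasDecompositions g r) :
    HasDecompositions (g ∘ standardBijection m X x) (m * r) := by
  classical
  intro Γ hΓ
  obtain ⟨Φ, hΦh, hΦ⟩ := exists_deformation_determined_on_unions x Γ hΓ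
  choose U hU T hTΓ hTm hΦT using hΦ
  obtain ⟨t, -, ht⟩ := isCompact_univ.elim_nhds_subcover (fun s => (U s : Set (Fin m → I)))
    fun s _ => (U s).isOpen.mem_nhds (hU s)
  have hΔ : ∀ s : Fin m → I, ∃ D ∈ t.image U, s ∈ D := by
    intro s
    obtain ⟨p, hp, hs⟩ := Set.mem_iUnion₂.1 (ht (Set.mem_univ s))
    exact ⟨U p, Finset.mem_image_of_mem U hp, hs⟩
  obtain ⟨gW, hgW⟩ := hr (t.image U) hΔ
  -- The part of the deformed spheroid over `W` is determined by the restriction of `a` to some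
  -- `F` in `Γ(m * r)`: the union of the sets attached to at most `r` members of `Δ` that form `W`.
  have key : ∀ W ∈ unionsOfAtMost (t.image U) r, ∃ F ∈ unionsOfAtMost Γ (m * r),
      ∀ a a' : Spheroid (m + 1) X x, Spheroid.restrict a F = Spheroid.restrict a' F →
        Spheroid.restrict (Φ (standardBijection m X x a)) W =
          Spheroid.restrict (Φ (standardBijection m X x a')) W := by
    intro W hW
    obtain ⟨S, hS, hSr, rfl⟩ := mem_unionsOfAtMost.1 hW
    have hpt : ∀ D ∈ S, ∃ p, U p = D := fun D hD => by
      obtain ⟨p, -, hp⟩ := Finset.mem_image.1 (hS hD)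
      exact ⟨p, hp⟩
    choose! pt hpt using hpt
    refine ⟨(S.biUnion fun D => T (pt D)).sup id, mem_unionsOfAtMost.2
      ⟨_, Finset.biUnion_subset.2 fun D _ => hTΓ _, ?_, rfl⟩, fun a a' haa' => ?_⟩
    · refine (Finset.card_biUnion_le_card_mul S _ m fun D _ => hTm _).trans ?_
      rw [mul_comm]
      exact Nat.mul_le_mul_left m hSr
    · refine Subtype.ext (ContinuousMap.ext fun ⟨s, hs⟩ => ?_)
      change Φ (standardBijection m X x a) s = Φ (standardBijection m X x a') s
      obtain ⟨D, hD, hsD⟩ : ∃ D ∈ S, s ∈ D := by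
        rw [Finset.sup_eq_iSup] at hs
        simpa using hs
      rw [← hpt D hD] at hsD
      refine hΦT (pt D) a a' (fun p hp => ?_) s hsD
      have hp' : p ∈ (S.biUnion fun D => T (pt D)).sup id :=
        Finset.sup_mono (f := id) (Finset.subset_biUnion_of_mem (fun D => T (pt D)) hD) hp
      exact DFunLike.congr_fun (congrArg Subtype.val haa') ⟨p, hp'⟩
  choose! e he hdet using key
  refine ⟨fun F b => ∑ W ∈ unionsOfAtMost (t.image U) r with e W = F,
    if h : ∃ a : Spheroid (m + 1) X x, Spheroid.restrict a F = b then
      gW W (Spheroid.restrict (Φ (standardBijection m X x h.choose)) W) else 0, fun a => ?_⟩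
  rw [Function.comp_apply, hg _ _ (hΦh _), hgW, ← Finset.sum_fiberwise_of_maps_to he]
  refine Finset.sum_congr rfl fun F _ => Finset.sum_congr rfl fun W hW => ?_
  obtain ⟨hW', rfl⟩ := Finset.mem_filter.1 hW
  have h : ∃ a' : Spheroid (m + 1) X x,
      Spheroid.restrict a' (e W) = Spheroid.restrict a (e W) := ⟨a, rfl⟩
  rw [dif_pos h, hdet W hW' _ _ h.choose_spec]

end SpheroidFunctional

theorem corollary3p2 {m : ℕ} (hm : 1 ≤ m) {X : Type*} [TopologicalSpace X]
    [SimplyConnectedSpace X] (x : X) {L : Type*} [AddCommGroup L]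
    (g : SpheroidFunctional.Spheroid m (LoopSpace X x) (Path.refl x) → L)
    (hg : SpheroidFunctional.HomotopyInvariant g) :
    SpheroidFunctional.degree (g ∘ SpheroidFunctional.standardBijection m X x) ≤
      (m : ℕ∞) * SpheroidFunctional.degree g := by
  by_cases h : ∃ r, SpheroidFunctional.HasDecompositions g r
  · obtain ⟨r, hr, hd⟩ : ∃ r, SpheroidFunctional.HasDecompositions g r ∧
        (r : ℕ∞) ≤ SpheroidFunctional.degree g := by
      classical
      exact ⟨Nat.find h, Nat.find_spec h, le_iInf₂ fun k hk =>
        Nat.cast_le.2 (Nat.find_min' h hk)⟩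
    calc SpheroidFunctional.degree (g ∘ SpheroidFunctional.standardBijection m X x)
        ≤ ((m * r : ℕ) : ℕ∞) := iInf₂_le (m * r) (hr.comp_standardBijection hg)
      _ = (m : ℕ∞) * r := Nat.cast_mul m r
      _ ≤ _ := by gcongr
  · have htop : SpheroidFunctional.degree g = ⊤ :=
      iInf₂_eq_top.2 fun r hr => absurd ⟨r, hr⟩ h
    rw [htop, ENat.mul_top (by exact_mod_cast Nat.one_le_iff_ne_zero.1 hm)]
    exact le_top
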